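/- All graphs are finite directed graphs $G=(V,E)$ with $E\subseteq V\times V$; the edge $(u,v)$ has origin $u$ and end $v$. A \emph{chain} of $G$ is a sequence of at least one edge of $G$, the end of each edge being the origin of the next one, with all its vertices different; $V_c$ is the set of vertices of the chain $c$, including both its ends. A \emph{circuit} is a non-empty closed oriented walk. A \emph{cycle} is a cycle of the underlying unoriented graph, i.e. its edges may be used in both directions; cycles that differ only by their starting point or their direction are identified. A graph without circuit is \emph{planar} if its vertices can be placed at different points of $\mathbb{R}\times\mathbb{R}$, with the edges drawn as straight segments, so that the origin of each edge is strictly to the left of its end, no edge passes through a vertex other than its extremities, and two different edges meet only at a common extremity. Let $G_{0,\infty}$ be obtained from $G$ by adding a vertex $0$ with an edge from $0$ to each vertex of $G$ that is not the end of an edge of $G$, and a vertex $\infty$ with an edge to $\infty$ from each vertex of $G$ that is not the origin of an edge of $G$. The graph $G$ is \emph{strongly planar} if $G_{0,\infty}$ is planar. The \emph{regions} of $G$ with respect to a chain $c$ are the subgraphs of $G$ induced by $V(K)\cup V_c$, where $K$ runs over the connected components of $G\setminus V_c$, the subgraph of $G$ induced by $V\setminus V_c$. \textbf{Proposition.} Let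 $G$ be a finite directed graph that is connected, has no circuit, and has no edge going from the beginning to the end of an oriented walk with at least two edges. If $G$ is strongly planar and has more than one cycle, then there is a chain $c$ of $G$ that has two regions, given by two different connected components of $G\setminus V_c$, each of which contains at least one cycle. -/

import Mathlib

/-! Finite directed graphs are `Digraph V` with `V` finite; an edge is an ordered pair `(u, v)` with
`G.Adj u v`, with origin `u` and end `v`. -/

namespace StronglyPlanar

universe u

variable {V : Type u}

/-- A chain, given by the list of its successive vertices: consecutive vertices are joined by an
edge of `G` in the forward direction, all vertices are different, and there is at least one edge. -/
def IsChain (G : Digraph V) (c : List V) : Prop :=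
  List.IsChain G.Adj c ∧ c.Nodup ∧ 2 ≤ c.length

/-- `G` has no circuit (oriented closed walk); in particular it has no loop and no pair of opposite
edges. -/
def NoCircuit (G : Digraph V) : Prop :=
  ∀ v, ¬ Relation.TransGen G.Adj v v

/-- No edge of `G` goes from the beginning to the end of an oriented walk with at least two
edges. -/
def NoTransitivity (G : Digraph V) : Prop :=
  ∀ u w v, G.Adj u w → Relation.TransGen G.Adj w v → ¬ G.Adj u v

/-- The set of cycles of an unoriented graph. A cycle is recorded by its set of edges, so that it is
counted only once, whatever its starting point and its direction. -/
def cycles {W : Type u} (H : SimpleGraph W) : Set (Set (Sym2 W)) :=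
  {s | ∃ (v : W) (w : H.Walk v v), w.IsCycle ∧ s = {e | e ∈ w.edges}}

/-- The number of cycles of a directed graph; the edges of a cycle may be used in both
directions. -/
noncomputable def numCycles (G : Digraph V) : ℕ∞ :=
  (cycles G.toSimpleGraphInclusive).encard

/-- The subgraph of `G` induced by a set `S` of vertices. -/
def induced (G : Digraph V) (S : Set V) : Digraph S where
  Adj x y := G.Adj x y

/-- The map `p` gives a drawing of `G` in `ℝ × ℝ` by straight segments, with the origin of each edge
strictly to the left of its end, and without edge-crossings: different vertices are drawn at
different points, an edge goes through no vertex other than its extremities, and two different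
edges meet only at a common extremity. -/
structure IsOrderedEmbedding (G : Digraph V) (p : V → ℝ × ℝ) : Prop where
  injective : Function.Injective p
  left_of : ∀ u v, G.Adj u v → (p u).1 < (p v).1
  vertex_edge : ∀ u v w, G.Adj u v → p w ∈ segment ℝ (p u) (p v) → w = u ∨ w = v
  edge_edge : ∀ u v u' v', G.Adj u v → G.Adj u' v' → (u, v) ≠ (u', v') →
    ∀ x ∈ segment ℝ (p u) (p v) ∩ segment ℝ (p u') (p v'),
      ∃ w, (w = u ∨ w = v) ∧ (w = u' ∨ w = v') ∧ x = p w

/-- `G` can be ordered-embedded in `ℝ × ℝ` without edge-crossings. -/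
def Planar (G : Digraph V) : Prop :=
  ∃ p : V → ℝ × ℝ, IsOrderedEmbedding G p

/-- The vertices of `G` together with a new vertex `zero` and a new vertex `infty`. -/
inductive ExtVertex (V : Type u) : Type u
  | zero : ExtVertex V
  | vert : V → ExtVertex V
  | infty : ExtVertex V

/-- The edges of the extended graph: those of `G`, an edge from `zero` to each vertex that is not
the end of an edge, and an edge to `infty` from each vertex that is not the origin of an edge. -/
inductive ExtAdj (G : Digraph V) : ExtVertex V → ExtVertex V → Prop
  | edge (u v : V) : G.Adj u v → ExtAdj G (.vert u) (.vert v)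
  | fromZero (v : V) : (∀ u, ¬ G.Adj u v) → ExtAdj G .zero (.vert v)
  | toInfty (v : V) : (∀ w, ¬ G.Adj v w) → ExtAdj G (.vert v) .infty

/-- The graph `G` with an added minimal vertex and an added maximal vertex. -/
def extend (G : Digraph V) : Digraph (ExtVertex V) where
  Adj := ExtAdj G

/-- `G` is strongly planar if its extension by a minimal and a maximal vertex is planar. -/
def IsStronglyPlanar (G : Digraph V) : Prop :=
  Planar (extend G)

/-- The connected components of `G` with the vertices of `c` removed. -/
abbrev Component (G : Digraph V) (c : List V) : Type u :=
  (induced G {v | v ∉ c}).toSimpleGraphInclusive.ConnectedComponent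

/-- The vertices of the region of `G` given by a component `A` of `G` with the vertices of `c`
removed: the vertices of `A` and those of `c`. -/
def regionVerts (G : Digraph V) (c : List V) (A : Component G c) : Set V :=
  (Subtype.val '' A.supp) ∪ {v | v ∈ c}

/-- The region of `G` given by a component `A`. -/
def region (G : Digraph V) (c : List V) (A : Component G c) : Digraph (regionVerts G c A) :=
  induced G (regionVerts G c A)

end StronglyPlanar

namespace StronglyPlanar

universe u

variable {V : Type u}

/-! Call excess of a set of vertices the number of edges minus the number of vertices of the
subgraph it induces. A non-empty set of excess at least 0 carries a cycle, and a connected graph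
with two cycles has excess at least 1.

In a drawing of the extended graph, the curves from `zero` to `infty` that follow edges are closed
under `max` and `min`, and no edge crosses them. The vertices of `G` on a curve form a path, of
excess -1 because there are no transitive edges. The excess of the part weakly below a curve is thus
-1 for the lowest curve and at least 1 for the highest. It rises by at most 1 from a curve to one
that covers it (`ncard_edgesIn_le_of_covering`), so it is 0 for some curve
(`exists_curve_ncard_eq`). By inclusion-exclusion, the part weakly above that curve has excess at
least 1 - 1 - 0 = 0.

Each of the two parts is a union of regions that share a chain of excess -1, so by pigeonhole one of
its regions has excess at least 0, hence a cycle (`exists_component_one_le_numCycles`). The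
components found below and above differ, since only vertices of the chain are on both sides. -/

/-! ### Cycles detected by counting edges and vertices. -/

/-- A forest extends to a spanning tree of the complete graph, whose number of edges is known. -/
theorem _root_.SimpleGraph.IsAcyclic.ncard_edgeSet_lt [Finite V] [Nonempty V] {H : SimpleGraph V}
    (hH : H.IsAcyclic) : H.edgeSet.ncard < Nat.card V := by
  obtain ⟨T, hT, -, hTt⟩ :=
    SimpleGraph.connected_top.exists_isTree_le_of_le_of_isAcyclic (le_top : H ≤ ⊤) hH
  have h1 := (SimpleGraph.isTree_iff_connected_and_card.1 hTt).2
  have h2 : H.edgeSet.ncard ≤ T.edgeSet.ncard :=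
    Set.ncard_le_ncard (SimpleGraph.edgeSet_mono hT) (Set.toFinite _)
  rw [Nat.card_coe_set_eq] at h1
  omega

theorem one_le_encard_cycles {H : SimpleGraph V} (hH : ¬ H.IsAcyclic) :
    1 ≤ (cycles H).encard := by
  simp only [SimpleGraph.IsAcyclic, not_forall, not_not] at hH
  obtain ⟨v, w, hw⟩ := hH
  exact Set.one_le_encard_iff_nonempty.2 ⟨_, v, w, hw, rfl⟩

/-- In a connected graph with at most as many edges as vertices, all cycles have the same edges. -/
theorem edges_subset_edges_of_isCycle [Finite V] {H : SimpleGraph V} (hc : H.Connected)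
    (hcard : H.edgeSet.ncard ≤ Nat.card V) {a b : V} {w : H.Walk a a} {w' : H.Walk b b}
    (hw : w.IsCycle) (hw' : w'.IsCycle) : w.edges ⊆ w'.edges := by
  intro e he
  by_contra hne
  induction e using Sym2.ind with
  | _ x y =>
  have hmem : s(x, y) ∈ H.edgeSet := w.edges_subset_edgeSet he
  have hbr : ¬ H.IsBridge s(x, y) := fun h =>
    (SimpleGraph.isBridge_iff_forall_cycle_notMem hmem).1 h w hw he
  have hcon := hc.connected_delete_edge_of_not_isBridge hbr
  have hdel : (H.deleteEdges {s(x, y)}).edgeSet.ncard + 1 = H.edgeSet.ncard := by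
    rw [SimpleGraph.edgeSet_deleteEdges]
    exact Set.ncard_sdiff_singleton_add_one hmem (Set.toFinite _)
  have hle := hcon.card_vert_le_card_edgeSet_add_one
  rw [Nat.card_coe_set_eq] at hle
  -- Connectedness and the edge count leave exactly one edge fewer than vertices; but `w'` avoids
  -- the deleted edge and survives in this tree.
  have htree : (H.deleteEdges {s(x, y)}).IsTree := by
    rw [SimpleGraph.isTree_iff_connected_and_card]
    refine ⟨hcon, ?_⟩
    rw [Nat.card_coe_set_eq]
    omega
  have htr : ∀ e ∈ w'.edges, e ∈ (H.deleteEdges {s(x, y)}).edgeSet := by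
    intro e he'
    rw [SimpleGraph.edgeSet_deleteEdges]
    refine ⟨w'.edges_subset_edgeSet he', ?_⟩
    rintro rfl
    exact hne he'
  exact htree.isAcyclic _ (hw'.transfer htr)

theorem card_lt_ncard_edgeSet_of_one_lt_encard_cycles [Finite V] {H : SimpleGraph V}
    (hc : H.Connected) (h : 1 < (cycles H).encard) : Nat.card V < H.edgeSet.ncard := by
  by_contra hle
  push Not at hle
  obtain ⟨s, t, ⟨a, w, hw, rfl⟩, ⟨b, w', hw', rfl⟩, hne⟩ := Set.one_lt_encard_iff.1 h
  apply hne
  ext e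
  exact ⟨fun he => edges_subset_edges_of_isCycle hc hle hw hw' he,
    fun he => edges_subset_edges_of_isCycle hc hle hw' hw he⟩

/-! ### Edge counts of induced subgraphs and of chains. -/

/-- The edges of `G` with both extremities in `W`. -/
def edgesIn (G : Digraph V) (W : Set V) : Set (V × V) :=
  {q | G.Adj q.1 q.2 ∧ q.1 ∈ W ∧ q.2 ∈ W}

theorem edgesIn_mono (G : Digraph V) {W W' : Set V} (h : W ⊆ W') : edgesIn G W ⊆ edgesIn G W' :=
  fun _ hq => ⟨hq.1, h hq.2.1, h hq.2.2⟩

theorem NoCircuit.asymm {G : Digraph V} (hG : NoCircuit G) {u v : V} (h : G.Adj u v) :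
    ¬ G.Adj v u :=
  fun h' => hG u (.tail (.single h) h')

theorem NoCircuit.ne {G : Digraph V} (hG : NoCircuit G) {u v : V} (h : G.Adj u v) : u ≠ v := by
  rintro rfl
  exact hG u (.single h)

/-- Without circuits, oriented and unoriented edges are in bijection. -/
theorem NoCircuit.ncard_edgeSet {G : Digraph V} (hG : NoCircuit G) :
    G.toSimpleGraphInclusive.edgeSet.ncard = {q : V × V | G.Adj q.1 q.2}.ncard := by
  symm
  refine Set.ncard_congr (fun q _ => s(q.1, q.2)) ?_ ?_ ?_
  · rintro ⟨u, v⟩ h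
    exact ⟨hG.ne h, Or.inl h⟩
  · rintro ⟨u, v⟩ ⟨u', v'⟩ h h' heq
    rcases Sym2.eq_iff.1 heq with ⟨h1, h2⟩ | ⟨h1, h2⟩
    · exact Prod.ext h1 h2
    · simp only at h1 h2
      subst h1 h2
      exact absurd h' (hG.asymm h)
  · intro e
    induction e using Sym2.ind with
    | _ x y =>
    rintro ⟨-, h | h⟩
    · exact ⟨(x, y), h, rfl⟩
    · exact ⟨(y, x), h, Sym2.eq_swap⟩

theorem NoCircuit.induced {G : Digraph V} (hG : NoCircuit G) (S : Set V) :
    NoCircuit (induced G S) :=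
  fun v h => hG v (h.lift (fun x : S => (x : V)) fun _ _ h => h)

theorem ncard_edges_induced (G : Digraph V) (S : Set V) :
    {q : S × S | (induced G S).Adj q.1 q.2}.ncard = (edgesIn G S).ncard := by
  refine Set.ncard_congr (fun q _ => ((q.1 : V), (q.2 : V))) ?_ ?_ ?_
  · rintro ⟨u, v⟩ h
    exact ⟨h, u.2, v.2⟩
  · rintro ⟨u, v⟩ ⟨u', v'⟩ _ _ heq
    simp only [Prod.mk.injEq] at heq
    exact Prod.ext (Subtype.ext heq.1) (Subtype.ext heq.2)
  · rintro ⟨u, v⟩ ⟨h, hu, hv⟩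
    exact ⟨(⟨u, hu⟩, ⟨v, hv⟩), h, rfl⟩

/-- A non-empty induced subgraph with at least as many edges as vertices has a cycle. -/
theorem NoCircuit.one_le_numCycles_induced [Finite V] {G : Digraph V} (hG : NoCircuit G)
    {S : Set V} (hne : S.Nonempty) (hcard : S.ncard ≤ (edgesIn G S).ncard) :
    1 ≤ numCycles (StronglyPlanar.induced G S) := by
  refine one_le_encard_cycles fun hac => ?_
  have : Nonempty S := hne.to_subtype
  have h1 := hac.ncard_edgeSet_lt
  rw [(hG.induced S).ncard_edgeSet, ncard_edges_induced, Nat.card_coe_set_eq] at h1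
  omega

theorem transGen_of_isChain_cons {r : V → V → Prop} {a : V} {l : List V}
    (h : List.IsChain r (a :: l)) : ∀ x ∈ l, Relation.TransGen r a x := by
  have h2 : List.IsChain (Relation.TransGen r) (a :: l) := h.imp fun _ _ h => .single h
  have h3 := List.isChain_iff_pairwise.1 h2
  exact (List.pairwise_cons.1 h3).1

theorem NoCircuit.nodup {G : Digraph V} (hG : NoCircuit G) {l : List V}
    (h : List.IsChain G.Adj l) : l.Nodup := by
  have h2 : List.IsChain (Relation.TransGen G.Adj) l := h.imp fun _ _ h => .single h
  refine (List.isChain_iff_pairwise.1 h2).imp ?_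
  rintro a b hab rfl
  exact hG a hab

theorem edgesIn_cons_cons {G : Digraph V} (hG : NoCircuit G) (hT : NoTransitivity G) {a b : V}
    {l : List V} (h : List.IsChain G.Adj (a :: b :: l)) :
    edgesIn G {v | v ∈ a :: b :: l} = insert (a, b) (edgesIn G {v | v ∈ b :: l}) := by
  have hab : G.Adj a b := (List.isChain_cons_cons.1 h).1
  have hbl := (List.isChain_cons_cons.1 h).2
  ext ⟨x, y⟩
  constructor
  · rintro ⟨hxy, hx, hy⟩
    change G.Adj x y at hxy
    change x ∈ a :: b :: l at hx
    change y ∈ a :: b :: l at hy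
    rcases List.mem_cons.1 hx with rfl | hx'
    · rcases List.mem_cons.1 hy with rfl | hy
      · exact absurd rfl (hG.ne hxy)
      · rcases List.mem_cons.1 hy with rfl | hy
        · exact Or.inl rfl
        · exact absurd hxy (hT _ _ _ hab (transGen_of_isChain_cons hbl _ hy))
    · rcases List.mem_cons.1 hy with rfl | hy
      · exact absurd ((transGen_of_isChain_cons h _ hx').tail hxy) (hG _)
      · exact Or.inr ⟨hxy, hx', hy⟩
  · rintro (heq | ⟨hxy, hx, hy⟩)
    · obtain ⟨rfl, rfl⟩ := Prod.mk.inj heq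
      exact ⟨hab, by simp, by simp⟩
    · exact ⟨hxy, List.mem_cons_of_mem _ hx, List.mem_cons_of_mem _ hy⟩

/-- The subgraph induced by a chain is a path: it has one vertex more than it has edges. -/
theorem ncard_edgesIn_chain [Finite V] {G : Digraph V} (hG : NoCircuit G) (hT : NoTransitivity G)
    {a : V} {l : List V} (h : List.IsChain G.Adj (a :: l)) :
    (edgesIn G {v | v ∈ a :: l}).ncard + 1 = {v | v ∈ a :: l}.ncard := by
  induction l generalizing a with
  | nil =>
    have h1 : edgesIn G {v | v ∈ [a]} = ∅ := by
      ext ⟨x, y⟩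
      simp only [edgesIn, List.mem_singleton, Set.mem_ofPred_eq, Set.mem_empty_iff_false, iff_false]
      rintro ⟨hxy, rfl, rfl⟩
      exact hG.ne hxy rfl
    have h2 : {v | v ∈ [a]} = {a} := by ext; simp
    rw [h1, h2]
    simp
  | cons b l ih =>
    have hnd := hG.nodup h
    have ha : a ∉ b :: l := (List.nodup_cons.1 hnd).1
    have h2 : {v | v ∈ a :: b :: l} = insert a {v | v ∈ b :: l} := by
      ext; simp
    rw [edgesIn_cons_cons hG hT h, h2, Set.ncard_insert_of_notMem (fun hm => ha hm.2.1)
      (Set.toFinite _), Set.ncard_insert_of_notMem (s := {v | v ∈ b :: l}) ha (Set.toFinite _),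
      ih (List.isChain_cons_cons.1 h).2]

/-! ### Components outside a chain, and the pigeonhole argument. -/

open Classical in
/-- The component of a vertex outside of `c`. -/
noncomputable def componentOf (G : Digraph V) (c : List V) (v : V) : Option (Component G c) :=
  if h : v ∉ c then some (SimpleGraph.connectedComponentMk _ ⟨v, h⟩) else none

theorem componentOf_eq_some {G : Digraph V} {c : List V} {v : V} {A : Component G c} :
    componentOf G c v = some A ↔ v ∈ Subtype.val '' A.supp := by
  unfold componentOf
  constructor
  · intro h
    split_ifs at h with hv
    exact ⟨⟨v, hv⟩, Option.some.inj h, rfl⟩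
  · rintro ⟨⟨x, hx⟩, hxA, rfl⟩
    exact (dif_pos hx).trans (congrArg some hxA)

theorem componentOf_eq_none {G : Digraph V} {c : List V} {v : V} :
    componentOf G c v = none ↔ v ∈ c := by
  unfold componentOf
  split_ifs with h <;> simpa using h

theorem componentOf_eq_of_adj {G : Digraph V} (hG : NoCircuit G) {c : List V} {u v : V}
    (h : G.Adj u v) (hu : u ∉ c) (hv : v ∉ c) : componentOf G c u = componentOf G c v := by
  unfold componentOf
  rw [dif_pos hu, dif_pos hv]
  refine congrArg some (SimpleGraph.ConnectedComponent.sound (SimpleGraph.Adj.reachable ?_))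
  exact ⟨fun heq => hG.ne h (congrArg Subtype.val heq), Or.inl h⟩

/-- A set of vertices that is closed under the edges outside of `c` contains the components that
it meets. -/
theorem component_subset {G : Digraph V} {c : List V} {W : Set V}
    (hW : ∀ u v, G.Adj u v → u ∉ c → v ∉ c → (u ∈ W ↔ v ∈ W)) {A : Component G c} {v : V}
    (hvA : v ∈ Subtype.val '' A.supp) (hvW : v ∈ W) : Subtype.val '' A.supp ⊆ W := by
  obtain ⟨x, hx, rfl⟩ := hvA
  rintro _ ⟨y, hy, rfl⟩
  have hr := SimpleGraph.ConnectedComponent.exact (hx.trans hy.symm)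
  obtain ⟨w⟩ := hr
  induction w with
  | nil => exact hvW
  | cons hadj _ ih =>
    rename_i a b _ _
    refine ih ?_ ?_ hy
    · exact (SimpleGraph.ConnectedComponent.sound (SimpleGraph.Adj.reachable hadj.symm)).trans hx
    · rcases hadj.2 with h | h
      · exact (hW _ _ h a.2 b.2).1 hvW
      · exact (hW _ _ h b.2 a.2).2 hvW

/-- If a union `W` of regions has at least as many edges as vertices, then one of these regions has
a cycle. -/
theorem exists_component_one_le_numCycles [Finite V] {G : Digraph V} (hG : NoCircuit G)
    {c : List V} {W : Set V} (hc : (edgesIn G {v | v ∈ c}).ncard + 1 = {v | v ∈ c}.ncard)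
    (hcW : {v | v ∈ c} ⊆ W) (hW : ∀ u v, G.Adj u v → u ∉ c → v ∉ c → (u ∈ W ↔ v ∈ W))
    (hcard : W.ncard ≤ (edgesIn G W).ncard) :
    ∃ A : Component G c, Subtype.val '' A.supp ⊆ W ∧ 1 ≤ numCycles (region G c A) := by
  classical
  have := Fintype.ofFinite V
  have : Finite (Component G c) := Quot.finite _
  have := Fintype.ofFinite (Component G c)
  set C : Set V := {v | v ∈ c} with hC
  let kV : V → Option (Component G c) := componentOf G c
  -- An edge not inside `c` is attributed to the component of an extremity outside `c`; if both are
  -- outside, they have the same component.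
  let kE : V × V → Option (Component G c) := fun q => if q.1 ∈ c then kV q.2 else kV q.1
  let sV : Finset V := (W \ C).toFinset
  let sE : Finset (V × V) := (edgesIn G W \ edgesIn G C).toFinset
  have hV : sV.card + C.ncard = W.ncard := by
    rw [← Set.ncard_eq_toFinset_card']
    exact Set.ncard_sdiff_add_ncard_of_subset hcW (Set.toFinite _)
  have hE : sE.card + (edgesIn G C).ncard = (edgesIn G W).ncard := by
    rw [← Set.ncard_eq_toFinset_card']
    exact Set.ncard_sdiff_add_ncard_of_subset (edgesIn_mono G hcW) (Set.toFinite _)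
  -- Strict because the chain has one edge fewer than vertices; some fibre therefore has more edges
  -- than vertices, and adding the chain back costs exactly this surplus of one.
  have hlt : sV.card < sE.card := by omega
  rw [Finset.card_eq_sum_card_fiberwise (f := kV) (t := Finset.univ) (fun _ _ => by simp),
    Finset.card_eq_sum_card_fiberwise (f := kE) (s := sE) (t := Finset.univ)
      (fun _ _ => by simp)] at hlt
  obtain ⟨k, -, hk⟩ := Finset.exists_lt_of_sum_lt hlt
  have hmemE : ∀ q, q ∈ sE.filter (fun q => kE q = k) →
      q ∈ edgesIn G W ∧ q ∉ edgesIn G C ∧ kE q = k := by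
    intro q hq
    simpa [sE, and_assoc] using hq
  obtain ⟨q, hq⟩ : (sE.filter (fun q => kE q = k)).Nonempty :=
    Finset.card_pos.1 (by omega)
  have hout : ∀ q ∈ edgesIn G W, q ∉ edgesIn G C → ∃ v ∈ W, v ∉ c ∧ kE q = kV v ∧
      (q.1 ∈ c ∨ kV q.1 = kV v) ∧ (q.2 ∈ c ∨ kV q.2 = kV v) := by
    rintro ⟨x, y⟩ ⟨hadj, hx, hy⟩ hn
    by_cases hxc : x ∈ c
    · have hyc : y ∉ c := fun hyc => hn ⟨hadj, hxc, hyc⟩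
      exact ⟨y, hy, hyc, by simp [kE, hxc], Or.inl hxc, Or.inr rfl⟩
    · refine ⟨x, hx, hxc, by simp [kE, hxc], Or.inr rfl, ?_⟩
      by_cases hyc : y ∈ c
      · exact Or.inl hyc
      · exact Or.inr (componentOf_eq_of_adj hG hadj hxc hyc).symm
  obtain ⟨hq1, hq2, hq3⟩ := hmemE q hq
  obtain ⟨v, hvW, hvc, hkv, -, -⟩ := hout q hq1 hq2
  rw [hq3] at hkv
  obtain ⟨A, rfl⟩ : ∃ A, k = some A := by
    cases k with
    | none => exact absurd (componentOf_eq_none.1 hkv.symm) hvc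
    | some A => exact ⟨A, rfl⟩
  have hAW : Subtype.val '' A.supp ⊆ W :=
    component_subset hW (componentOf_eq_some.1 hkv.symm) hvW
  refine ⟨A, hAW, ?_⟩
  refine hG.one_le_numCycles_induced ⟨v, Or.inl (componentOf_eq_some.1 hkv.symm)⟩ ?_
  have h1 : regionVerts G c A = ((sV.filter (fun v => kV v = some A) : Finset V) : Set V) ∪ C := by
    ext x
    simp only [regionVerts, Finset.coe_filter, Set.mem_union, Set.mem_ofPred_eq, sV, hC,
      Set.mem_toFinset, Set.mem_sdiff, kV, componentOf_eq_some]
    constructor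
    · rintro (h | h)
      · obtain ⟨y, hy, rfl⟩ := h
        exact Or.inl ⟨⟨hAW ⟨y, hy, rfl⟩, y.2⟩, ⟨y, hy, rfl⟩⟩
      · exact Or.inr h
    · rintro (h | h)
      · exact Or.inl h.2
      · exact Or.inr h
  have h2 : (regionVerts G c A).ncard ≤ (sV.filter (fun v => kV v = some A)).card + C.ncard := by
    rw [h1, ← Set.ncard_coe_finset]
    exact Set.ncard_union_le _ _
  have h3 : ((sE.filter (fun q => kE q = some A) : Finset (V × V)) : Set (V × V)) ∪ edgesIn G C ⊆
      edgesIn G (regionVerts G c A) := by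
    rintro q (hq | hq)
    · obtain ⟨hq1, hq2, hq3⟩ := hmemE q hq
      obtain ⟨v, -, -, hkv, ha, hb⟩ := hout q hq1 hq2
      rw [← hkv, hq3] at ha hb
      refine ⟨hq1.1, ?_, ?_⟩
      · exact ha.elim Or.inr fun h => Or.inl (componentOf_eq_some.1 h)
      · exact hb.elim Or.inr fun h => Or.inl (componentOf_eq_some.1 h)
    · exact edgesIn_mono G (fun x hx => Or.inr hx) hq
  have h4 := Set.ncard_le_ncard h3 (Set.toFinite _)
  rw [Set.ncard_union_eq ?_ (Set.toFinite _) (Set.toFinite _), Set.ncard_coe_finset] at h4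
  · omega
  · rw [Set.disjoint_left]
    intro q hq
    exact (hmemE q hq).2.1

/-! ### Curves that follow the edges of a drawing. -/

section Curves

variable {X : Type u} {L : Digraph X} {p : X → ℝ × ℝ} {z t : X}

theorem wellFounded_left [Finite X] (p : X → ℝ × ℝ) :
    WellFounded fun a b : X => (p a).1 < (p b).1 :=
  have : IsTrans X fun a b => (p a).1 < (p b).1 := ⟨fun _ _ _ => lt_trans⟩
  have : Std.Irrefl fun a b : X => (p a).1 < (p b).1 := ⟨fun _ => lt_irrefl _⟩
  Finite.wellFounded_of_trans_of_irrefl _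

theorem wellFounded_right [Finite X] (p : X → ℝ × ℝ) :
    WellFounded fun a b : X => (p b).1 < (p a).1 :=
  have : IsTrans X fun a b => (p b).1 < (p a).1 := ⟨fun _ _ _ h h' => lt_trans h' h⟩
  have : Std.Irrefl fun a b : X => (p b).1 < (p a).1 := ⟨fun _ => lt_irrefl _⟩
  Finite.wellFounded_of_trans_of_irrefl _

/-- The ordinate at `x` of the straight line from `p u` to `p v`; constant if `u = v`. -/
noncomputable def line (p : X → ℝ × ℝ) (u v : X) (x : ℝ) : ℝ :=
  (p u).2 + (x - (p u).1) / ((p v).1 - (p u).1) * ((p v).2 - (p u).2)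

theorem continuous_line (p : X → ℝ × ℝ) (u v : X) : Continuous (line p u v) := by
  unfold line
  fun_prop

theorem line_self (p : X → ℝ × ℝ) (u : X) (x : ℝ) : line p u u x = (p u).2 := by
  simp [line]

theorem line_left (p : X → ℝ × ℝ) (u v : X) : line p u v (p u).1 = (p u).2 := by
  simp [line]

theorem line_right {u v : X} (h : (p u).1 < (p v).1) : line p u v (p v).1 = (p v).2 := by
  have : (p v).1 - (p u).1 ≠ 0 := by linarith
  simp [line, div_self this]

theorem mem_segment_of_line {u v : X} (h : (p u).1 < (p v).1) {x y : ℝ}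
    (hx : x ∈ Set.Icc (p u).1 (p v).1) (hy : y = line p u v x) :
    (x, y) ∈ segment ℝ (p u) (p v) := by
  have hpos : 0 < (p v).1 - (p u).1 := by linarith
  rw [segment_eq_image']
  refine ⟨(x - (p u).1) / ((p v).1 - (p u).1), ⟨?_, ?_⟩, ?_⟩
  · exact div_nonneg (by linarith [hx.1]) hpos.le
  · rw [div_le_one hpos]
    linarith [hx.2]
  · refine Prod.ext ?_ ?_
    · simp only [Prod.fst_add, Prod.smul_fst, Prod.fst_sub, smul_eq_mul]
      field_simp
      ring
    · simp only [Prod.snd_add, Prod.smul_snd, Prod.snd_sub, smul_eq_mul]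
      rw [hy, line]

/-- Two different edges meet only at a common extremity, whose abscissa cannot be strictly inside
the first edge. -/
theorem IsOrderedEmbedding.eq_of_line_eq (hp : IsOrderedEmbedding L p) {u v u' v' : X}
    (h : L.Adj u v) (h' : L.Adj u' v') {x : ℝ} (hx : x ∈ Set.Ioo (p u).1 (p v).1)
    (hx' : x ∈ Set.Icc (p u').1 (p v').1) (heq : line p u v x = line p u' v' x) :
    u = u' ∧ v = v' := by
  by_contra hne
  obtain ⟨w, hw, -, hxw⟩ := hp.edge_edge u v u' v' h h' (fun he => hne (Prod.mk.inj he))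
    (x, line p u v x) ⟨mem_segment_of_line (hp.left_of _ _ h) ⟨hx.1.le, hx.2.le⟩ rfl,
      mem_segment_of_line (hp.left_of _ _ h') hx' heq⟩
  have hx1 : x = (p w).1 := congrArg Prod.fst hxw
  rcases hw with rfl | rfl
  · exact hx.1.ne' hx1
  · exact hx.2.ne hx1

theorem IsOrderedEmbedding.eq_or_eq_of_line (hp : IsOrderedEmbedding L p) {u v w : X}
    (h : L.Adj u v) (hx : (p w).1 ∈ Set.Icc (p u).1 (p v).1)
    (heq : (p w).2 = line p u v (p w).1) : w = u ∨ w = v :=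
  hp.vertex_edge u v w h (mem_segment_of_line (hp.left_of _ _ h) hx heq)

/-- `f` is continuous and its graph over `[a, b]` lies in the drawing of `L` given by `p`. -/
structure IsCurve (L : Digraph X) (p : X → ℝ × ℝ) (a b : ℝ) (f : ℝ → ℝ) : Prop where
  continuous : Continuous f
  drawn : ∀ x ∈ Set.Icc a b, ∃ u v, L.Adj u v ∧ x ∈ Set.Icc (p u).1 (p v).1 ∧ f x = line p u v x

theorem IsCurve.select {a b : ℝ} {f g h : ℝ → ℝ} (hf : IsCurve L p a b f) (hg : IsCurve L p a b g)
    (hc : Continuous h) (hh : ∀ x, h x = f x ∨ h x = g x) : IsCurve L p a b h := by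
  refine ⟨hc, fun x hx => ?_⟩
  rcases hh x with h | h <;> rw [h]
  · exact hf.drawn x hx
  · exact hg.drawn x hx

theorem IsCurve.max {a b : ℝ} {f g : ℝ → ℝ} (hf : IsCurve L p a b f) (hg : IsCurve L p a b g) :
    IsCurve L p a b fun x => max (f x) (g x) :=
  hf.select hg (hf.continuous.max hg.continuous) fun x => max_choice (f x) (g x)

theorem IsCurve.min {a b : ℝ} {f g : ℝ → ℝ} (hf : IsCurve L p a b f) (hg : IsCurve L p a b g) :
    IsCurve L p a b fun x => min (f x) (g x) :=
  hf.select hg (hf.continuous.min hg.continuous) fun x => min_choice (f x) (g x)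

theorem IsCurve.glue {a b c : ℝ} {f g : ℝ → ℝ} (hf : IsCurve L p a b f) (hg : IsCurve L p b c g)
    (heq : f b = g b) : IsCurve L p a c fun x => if x ≤ b then f x else g x := by
  refine ⟨hf.continuous.if_le hg.continuous continuous_id continuous_const ?_, fun x hx => ?_⟩
  · rintro x rfl
    exact heq
  · split_ifs with h
    · exact hf.drawn x ⟨hx.1, h⟩
    · exact hg.drawn x ⟨(not_le.1 h).le, hx.2⟩

theorem IsCurve.mono {a b a' b' : ℝ} {f : ℝ → ℝ} (hf : IsCurve L p a b f) (ha : a ≤ a')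
    (hb : b' ≤ b) : IsCurve L p a' b' f :=
  ⟨hf.continuous, fun x hx => hf.drawn x ⟨ha.trans hx.1, hx.2.trans hb⟩⟩

theorem isCurve_line {u v : X} (h : L.Adj u v) : IsCurve L p (p u).1 (p v).1 (line p u v) :=
  ⟨continuous_line p u v, fun _ hx => ⟨u, v, h, hx, rfl⟩⟩

/-- A drawing in which every vertex other than `z` is the end of an edge, and every vertex other
than `t` is the origin of an edge. -/
structure IsBounded (L : Digraph X) (p : X → ℝ × ℝ) (z t : X) : Prop
    extends IsOrderedEmbedding L p where
  exists_in : ∀ v, v ≠ z → ∃ u, L.Adj u v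
  exists_out : ∀ v, v ≠ t → ∃ w, L.Adj v w
  ne : z ≠ t

namespace IsBounded

variable [Finite X]

/-- A leftmost vertex is the end of no edge, so it must be `z`. -/
theorem le_left (hp : IsBounded L p z t) (v : X) : (p z).1 ≤ (p v).1 := by
  have : Nonempty X := ⟨v⟩
  obtain ⟨m, hm⟩ := Finite.exists_min fun v => (p v).1
  by_cases h : m = z
  · exact h ▸ hm v
  · obtain ⟨u, hu⟩ := hp.exists_in m h
    exact absurd (hm u) (not_le.2 (hp.left_of _ _ hu))

theorem le_right (hp : IsBounded L p z t) (v : X) : (p v).1 ≤ (p t).1 := by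
  have : Nonempty X := ⟨v⟩
  obtain ⟨m, hm⟩ := Finite.exists_max fun v => (p v).1
  by_cases h : m = t
  · exact h ▸ hm v
  · obtain ⟨u, hu⟩ := hp.exists_out m h
    exact absurd (hm u) (not_le.2 (hp.left_of _ _ hu))

theorem mem_Icc (hp : IsBounded L p z t) (v : X) : (p v).1 ∈ Set.Icc (p z).1 (p t).1 :=
  ⟨hp.le_left v, hp.le_right v⟩

theorem lt_left (hp : IsBounded L p z t) {v : X} (h : v ≠ z) : (p z).1 < (p v).1 := by
  obtain ⟨u, hu⟩ := hp.exists_in v h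
  exact (hp.le_left u).trans_lt (hp.left_of _ _ hu)

theorem lt_right (hp : IsBounded L p z t) {v : X} (h : v ≠ t) : (p v).1 < (p t).1 := by
  obtain ⟨u, hu⟩ := hp.exists_out v h
  exact (hp.left_of _ _ hu).trans_le (hp.le_right u)

/-- There is a path from `z` to each vertex. -/
theorem exists_curve_left (hp : IsBounded L p z t) (v : X) (hv : v ≠ z) :
    ∃ f, IsCurve L p (p z).1 (p v).1 f ∧ f (p v).1 = (p v).2 := by
  induction v using (wellFounded_left p).induction with
  | _ v ih =>
  obtain ⟨u, hu⟩ := hp.exists_in v hv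
  have hlt := hp.left_of _ _ hu
  by_cases huz : u = z
  · subst huz
    exact ⟨_, isCurve_line hu, line_right hlt⟩
  · obtain ⟨f, hf, hfu⟩ := ih u hlt huz
    refine ⟨_, hf.glue (isCurve_line hu) (hfu.trans (line_left p u v).symm), ?_⟩
    simp only [not_le.2 hlt, if_false, line_right hlt]

/-- There is a path from each vertex to `t`. -/
theorem exists_curve_right (hp : IsBounded L p z t) (v : X) (hv : v ≠ t) :
    ∃ f, IsCurve L p (p v).1 (p t).1 f ∧ f (p v).1 = (p v).2 := by
  induction v using (wellFounded_right p).induction with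
  | _ v ih =>
  obtain ⟨u, hu⟩ := hp.exists_out v hv
  have hlt := hp.left_of _ _ hu
  by_cases huz : u = t
  · subst huz
    exact ⟨_, isCurve_line hu, line_left p v u⟩
  · obtain ⟨f, hf, hfu⟩ := ih u hlt huz
    refine ⟨_, (isCurve_line hu).glue hf ((line_right hlt).trans hfu.symm), ?_⟩
    simp only [hlt.le, if_true, line_left]

/-- There is a path from `z` to `t` through each edge. -/
theorem exists_curve_edge (hp : IsBounded L p z t) {u v : X} (h : L.Adj u v) :
    ∃ f, IsCurve L p (p z).1 (p t).1 f ∧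
      ∀ x ∈ Set.Icc (p u).1 (p v).1, f x = line p u v x := by
  have hlt := hp.left_of _ _ h
  obtain ⟨f, hf, hfu⟩ : ∃ f, IsCurve L p (p z).1 (p v).1 f ∧
      ∀ x ∈ Set.Icc (p u).1 (p v).1, f x = line p u v x := by
    by_cases huz : u = z
    · subst huz
      exact ⟨_, isCurve_line h, fun _ _ => rfl⟩
    · obtain ⟨f, hf, hfu⟩ := hp.exists_curve_left u huz
      refine ⟨_, hf.glue (isCurve_line h) (hfu.trans (line_left p u v).symm), fun x hx => ?_⟩
      by_cases hxu : x ≤ (p u).1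
      · have hxe : x = (p u).1 := le_antisymm hxu hx.1
        simp only [hxe, le_refl, if_true, hfu, line_left]
      · simp only [hxu, if_false]
  by_cases hvt : v = t
  · subst hvt
    exact ⟨f, hf, hfu⟩
  · obtain ⟨g, hg, hgv⟩ := hp.exists_curve_right v hvt
    have hfv : f (p v).1 = (p v).2 := (hfu _ ⟨hlt.le, le_rfl⟩).trans (line_right hlt)
    refine ⟨_, hf.glue hg (hfv.trans hgv.symm), fun x hx => ?_⟩
    simp only [hx.2, if_true, hfu x hx]

theorem exists_curve_vertex (hp : IsBounded L p z t) (v : X) :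
    ∃ f, IsCurve L p (p z).1 (p t).1 f ∧ f (p v).1 = (p v).2 := by
  by_cases h : v = t
  · obtain ⟨u, hu⟩ := hp.exists_in v (h ▸ hp.ne.symm)
    obtain ⟨f, hf, hfu⟩ := hp.exists_curve_edge hu
    have hlt := hp.left_of _ _ hu
    exact ⟨f, hf, (hfu _ ⟨hlt.le, le_rfl⟩).trans (line_right hlt)⟩
  · obtain ⟨u, hu⟩ := hp.exists_out v h
    obtain ⟨f, hf, hfu⟩ := hp.exists_curve_edge hu
    have hlt := hp.left_of _ _ hu
    exact ⟨f, hf, (hfu _ ⟨le_rfl, hlt.le⟩).trans (line_left p v u)⟩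

/-- A curve that meets the interior of an edge follows this edge. -/
theorem follow (hp : IsBounded L p z t) {f : ℝ → ℝ} (hf : IsCurve L p (p z).1 (p t).1 f) {u v : X}
    (h : L.Adj u v) {x₀ : ℝ} (hx₀ : x₀ ∈ Set.Ioo (p u).1 (p v).1) (hfx₀ : f x₀ = line p u v x₀) :
    ∀ x ∈ Set.Icc (p u).1 (p v).1, f x = line p u v x := by
  have hlt := hp.left_of _ _ h
  -- `A` and `B` are closed, cover the open interval and are disjoint in it, since the drawing has
  -- no crossing. By connectedness the interval lies in `A`; the endpoints follow by closure.
  let A : Set ℝ := {x | f x = line p u v x}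
  let B : Set ℝ := ⋃ q : {q : X × X // L.Adj q.1 q.2 ∧ q ≠ (u, v)},
    Set.Icc (p q.1.1).1 (p q.1.2).1 ∩ {x | f x = line p q.1.1 q.1.2 x}
  have hA : IsClosed A := isClosed_eq hf.continuous (continuous_line p u v)
  have hB : IsClosed B := isClosed_iUnion_of_finite fun q =>
    isClosed_Icc.inter (isClosed_eq hf.continuous (continuous_line p _ _))
  have hcov : Set.Ioo (p u).1 (p v).1 ⊆ A ∪ B := by
    intro x hx
    obtain ⟨a, b, hab, hx', hfx⟩ := hf.drawn x
      ⟨(hp.le_left u).trans hx.1.le, hx.2.le.trans (hp.le_right v)⟩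
    by_cases he : (a, b) = (u, v)
    · obtain ⟨rfl, rfl⟩ := Prod.mk.inj he
      exact Or.inl hfx
    · exact Or.inr (Set.mem_iUnion.2 ⟨⟨(a, b), hab, he⟩, hx', hfx⟩)
  have hAB : ∀ x ∈ Set.Ioo (p u).1 (p v).1, x ∈ A → x ∉ B := by
    intro x hx hxA hxB
    obtain ⟨⟨⟨a, b⟩, hab, hne⟩, hx', hfx⟩ := Set.mem_iUnion.1 hxB
    obtain ⟨rfl, rfl⟩ := hp.eq_of_line_eq h hab hx hx' (Eq.trans (Eq.symm hxA) hfx)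
    exact hne rfl
  have hin : Set.Ioo (p u).1 (p v).1 ⊆ A := by
    intro x hx
    by_contra hxA
    obtain ⟨y, hy, hyA, hyB⟩ := isPreconnected_closed_iff.1 isPreconnected_Ioo A B hA hB hcov
      ⟨x₀, hx₀, hfx₀⟩ ⟨x, hx, (hcov hx).resolve_left hxA⟩
    exact hAB y hy hyA hyB
  have hcl := closure_minimal hin hA
  rw [closure_Ioo hlt.ne] at hcl
  exact hcl

/-- An edge is either weakly above or weakly below each curve. -/
theorem le_or_ge (hp : IsBounded L p z t) {f : ℝ → ℝ} (hf : IsCurve L p (p z).1 (p t).1 f)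
    {u v : X} (h : L.Adj u v) :
    (∀ x ∈ Set.Icc (p u).1 (p v).1, line p u v x ≤ f x) ∨
      ∀ x ∈ Set.Icc (p u).1 (p v).1, f x ≤ line p u v x := by
  by_contra hcon
  push Not at hcon
  obtain ⟨⟨x, hx, hfx⟩, y, hy, hfy⟩ := hcon
  -- A change of side forces a meeting in the interior of the edge, after which `follow` makes the
  -- curve equal to the edge throughout.
  have hivt := intermediate_value_uIcc (a := x) (b := y) (f := fun s => f s - line p u v s)
    (hf.continuous.sub (continuous_line p u v)).continuousOn
  obtain ⟨s, hs, hs0⟩ := hivt (Set.mem_uIcc.2 (Or.inl ⟨by linarith, by linarith⟩) :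
    (0 : ℝ) ∈ Set.uIcc (f x - line p u v x) (f y - line p u v y))
  have hs0' : f s = line p u v s := by
    have : f s - line p u v s = 0 := hs0
    linarith
  have hsx : s ≠ x := by
    rintro rfl
    linarith
  have hsy : s ≠ y := by
    rintro rfl
    linarith
  have hsI : s ∈ Set.Ioo (p u).1 (p v).1 := by
    rcases Set.mem_uIcc.1 hs with ⟨h1, h2⟩ | ⟨h1, h2⟩
    · exact ⟨hx.1.trans_lt (lt_of_le_of_ne h1 hsx.symm), (lt_of_le_of_ne h2 hsy).trans_le hy.2⟩
    · exact ⟨hy.1.trans_lt (lt_of_le_of_ne h1 hsy.symm), (lt_of_le_of_ne h2 hsx).trans_le hx.2⟩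
  have := hp.follow hf h hsI hs0' x hx
  linarith

theorem curve_left (hp : IsBounded L p z t) {f : ℝ → ℝ} (hf : IsCurve L p (p z).1 (p t).1 f) :
    f (p z).1 = (p z).2 := by
  obtain ⟨a, b, hab, hx, hfx⟩ := hf.drawn _ (hp.mem_Icc z)
  by_cases h : a = z
  · subst h
    rw [hfx, line_left]
  · exact absurd hx.1 (not_le.2 (hp.lt_left h))

/-- A vertex of a curve has a successor on this curve. -/
theorem exists_succ (hp : IsBounded L p z t) {f : ℝ → ℝ} (hf : IsCurve L p (p z).1 (p t).1 f)
    {u : X} (hu : f (p u).1 = (p u).2) (hut : u ≠ t) :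
    ∃ v, L.Adj u v ∧ ∀ x ∈ Set.Icc (p u).1 (p v).1, f x = line p u v x := by
  -- A point `x` just right of `u`, before the next vertex abscissa, is interior to the edge drawn
  -- there; that edge passes through `u`, so it starts at `u`.
  have hev : ∀ᶠ x in nhdsWithin (p u).1 (Set.Ioi (p u).1), ∀ w : X, (p u).1 < (p w).1 →
      x < (p w).1 := by
    rw [Filter.eventually_all]
    intro w
    by_cases hw : (p u).1 < (p w).1
    · filter_upwards [Ioo_mem_nhdsGT hw] with x hx _ using hx.2
    · exact Filter.Eventually.of_forall fun x h => absurd h hw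
  obtain ⟨x, hx, hux⟩ := (hev.and self_mem_nhdsWithin).exists
  have hux : (p u).1 < x := hux
  obtain ⟨a, b, hab, hxab, hfx⟩ := hf.drawn x
    ⟨(hp.le_left u).trans hux.le, (hx t (hp.lt_right hut)).le⟩
  have hau : (p a).1 ≤ (p u).1 := by
    by_contra hlt
    exact absurd hxab.1 (not_le.2 (hx a (not_le.1 hlt)))
  have hub : (p u).1 < (p b).1 := hux.trans_le hxab.2
  have hfol := hp.follow hf hab ⟨hau.trans_lt hux, hx b hub⟩ hfx
  rcases hp.eq_or_eq_of_line hab ⟨hau, hub.le⟩ (hu.symm.trans (hfol _ ⟨hau, hub.le⟩)) with h | h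
  · subst h
    exact ⟨b, hab, hfol⟩
  · subst h
    exact absurd hub (lt_irrefl _)

end IsBounded

end Curves

/-! ### The order on curves, encoded by finite sets. -/

section Order

variable {X : Type u} {L : Digraph X} {p : X → ℝ × ℝ} {z t : X}

theorem exists_max_of_le {α : Type*} {s : Set α} (hs : s.Nonempty) (m : α → ℕ) (N : ℕ)
    (hN : ∀ a, m a ≤ N) : ∃ a ∈ s, ∀ b ∈ s, m b ≤ m a := by
  obtain ⟨a, ha, hmin⟩ := (measure fun a => N - m a).wf.has_min s hs
  refine ⟨a, ha, fun b hb => ?_⟩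
  have h1 : ¬ N - m b < N - m a := hmin b hb
  have := hN a
  have := hN b
  omega

/-- The vertices (as diagonal pairs) and the edges that are weakly below `f`. -/
def below (L : Digraph X) (p : X → ℝ × ℝ) (f : ℝ → ℝ) : Set (X × X) :=
  {q | (q.1 = q.2 ∨ L.Adj q.1 q.2) ∧
    ∀ x ∈ Set.Icc (p q.1).1 (p q.2).1, line p q.1 q.2 x ≤ f x}

namespace IsBounded

variable [Finite X]

theorem below_subset (hp : IsBounded L p z t) {f g : ℝ → ℝ}
    (h : ∀ x ∈ Set.Icc (p z).1 (p t).1, f x ≤ g x) : below L p f ⊆ below L p g :=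
  fun _ hq => ⟨hq.1, fun x hx => (hq.2 x hx).trans
    (h x ⟨(hp.le_left _).trans hx.1, hx.2.trans (hp.le_right _)⟩)⟩

/-- Every point of `f` is a vertex or lies on an edge that `f` follows entirely, and these belong to
`below L p f`. The order on curves over the drawing is thus read off from finite sets. -/
theorem le_of_below_subset (hp : IsBounded L p z t) {f g : ℝ → ℝ}
    (hf : IsCurve L p (p z).1 (p t).1 f) (h : below L p f ⊆ below L p g) :
    ∀ x ∈ Set.Icc (p z).1 (p t).1, f x ≤ g x := by
  have hvert : ∀ v, (p v).2 = f (p v).1 → f (p v).1 ≤ g (p v).1 := by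
    intro v hv
    have hmem : (v, v) ∈ below L p f := by
      refine ⟨Or.inl rfl, fun x hx => ?_⟩
      have hxv : x = (p v).1 := le_antisymm hx.2 hx.1
      rw [line_self, hxv]
      exact hv.le
    have h1 := (h hmem).2 (p v).1 ⟨le_rfl, le_rfl⟩
    rw [line_self] at h1
    exact hv.symm.trans_le h1
  intro x hx
  obtain ⟨a, b, hab, hxab, hfx⟩ := hf.drawn x hx
  rcases hxab.1.eq_or_lt with ha | ha
  · subst ha
    exact hvert a ((line_left p a b).symm.trans hfx.symm)
  rcases hxab.2.eq_or_lt with hb | hb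
  · subst hb
    exact hvert b ((line_right (hp.left_of _ _ hab)).symm.trans hfx.symm)
  have hfol := hp.follow hf hab ⟨ha, hb⟩ hfx
  have hmem : (a, b) ∈ below L p f := ⟨Or.inr hab, fun y hy => (hfol y hy).ge⟩
  rw [hfx]
  exact (h hmem).2 x hxab

/-- The cardinality of `below` is strictly monotone in this sense, so extremal curves can be chosen
by a natural number. -/
theorem le_of_ncard_le (hp : IsBounded L p z t) {f g : ℝ → ℝ}
    (hg : IsCurve L p (p z).1 (p t).1 g) (h : ∀ x ∈ Set.Icc (p z).1 (p t).1, f x ≤ g x)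
    (hcard : (below L p g).ncard ≤ (below L p f).ncard) :
    ∀ x ∈ Set.Icc (p z).1 (p t).1, g x ≤ f x :=
  hp.le_of_below_subset hg
    (Set.eq_of_subset_of_ncard_le (hp.below_subset h) hcard (Set.toFinite _)).ge

theorem exists_lowest (hp : IsBounded L p z t) : ∃ f, IsCurve L p (p z).1 (p t).1 f ∧
    ∀ g, IsCurve L p (p z).1 (p t).1 g → ∀ x ∈ Set.Icc (p z).1 (p t).1, f x ≤ g x := by
  obtain ⟨f₀, hf₀, -⟩ := hp.exists_curve_vertex z
  obtain ⟨f, hf, hmin⟩ := (measure fun f => (below L p f).ncard).wf.has_min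
    {f | IsCurve L p (p z).1 (p t).1 f} ⟨f₀, hf₀⟩
  refine ⟨f, hf, fun g hg x hx => ?_⟩
  have hle := hp.le_of_ncard_le hf (f := fun x => min (f x) (g x))
    (fun x _ => min_le_left _ _) (not_lt.1 (hmin _ (hf.min hg)))
  exact (hle x hx).trans (min_le_right _ _)

theorem exists_highest (hp : IsBounded L p z t) : ∃ f, IsCurve L p (p z).1 (p t).1 f ∧
    ∀ g, IsCurve L p (p z).1 (p t).1 g → ∀ x ∈ Set.Icc (p z).1 (p t).1, g x ≤ f x := by
  obtain ⟨f₀, hf₀, -⟩ := hp.exists_curve_vertex z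
  obtain ⟨f, hf, hmax⟩ := exists_max_of_le (s := {f | IsCurve L p (p z).1 (p t).1 f}) ⟨f₀, hf₀⟩
    (fun f => (below L p f).ncard) _ (fun f => Set.ncard_le_card (below L p f))
  refine ⟨f, hf, fun g hg x hx => ?_⟩
  have hle := hp.le_of_ncard_le (hf.max hg) (f := f)
    (fun x _ => le_max_left _ _) (hmax _ (hf.max hg))
  exact (le_max_right _ _).trans (hle x hx)

end IsBounded

end Order

/-! ### Curves in the extended graph, and the excess below them. -/

section Extend

variable {V : Type u} {G : Digraph V} {p : ExtVertex V → ℝ × ℝ}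

instance [Finite V] : Finite (ExtVertex V) := by
  refine Finite.of_surjective (α := Option (Option V)) (fun o => match o with
    | none => .zero
    | some none => .infty
    | some (some v) => .vert v) ?_
  rintro (_ | v | _)
  · exact ⟨none, rfl⟩
  · exact ⟨some (some v), rfl⟩
  · exact ⟨some none, rfl⟩

theorem isBounded_extend [Finite V] [Nonempty V] (hp : IsOrderedEmbedding (extend G) p) :
    IsBounded (extend G) p .zero .infty where
  toIsOrderedEmbedding := hp
  ne := by simp
  exists_in v hv := by
    cases v with
    | zero => exact absurd rfl hv
    | vert a =>
      by_cases h : ∃ u, G.Adj u a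
      · obtain ⟨u, hu⟩ := h
        exact ⟨_, .edge u a hu⟩
      · exact ⟨_, .fromZero a (not_exists.1 h)⟩
    | infty =>
      obtain ⟨m, hm⟩ := Finite.exists_max fun v : V => (p (.vert v)).1
      refine ⟨_, .toInfty m fun w hw => ?_⟩
      exact absurd (hm w) (not_le.2 (hp.left_of _ _ (.edge m w hw)))
  exists_out v hv := by
    cases v with
    | infty => exact absurd rfl hv
    | vert a =>
      by_cases h : ∃ w, G.Adj a w
      · obtain ⟨w, hw⟩ := h
        exact ⟨_, .edge a w hw⟩
      · exact ⟨_, .toInfty a (not_exists.1 h)⟩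
    | zero =>
      obtain ⟨m, hm⟩ := Finite.exists_min fun v : V => (p (.vert v)).1
      refine ⟨_, .fromZero m fun w hw => ?_⟩
      exact absurd (hm w) (not_le.2 (hp.left_of _ _ (.edge w m hw)))

/-- The vertices of `G` on the curve `f`. -/
def onCurve (p : ExtVertex V → ℝ × ℝ) (f : ℝ → ℝ) : Set V :=
  {v | f (p (.vert v)).1 = (p (.vert v)).2}

/-- The vertices of `G` weakly below the curve `f`. -/
def weaklyBelow (p : ExtVertex V → ℝ × ℝ) (f : ℝ → ℝ) : Set V :=
  {v | (p (.vert v)).2 ≤ f (p (.vert v)).1}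

/-- The vertices of `G` weakly above the curve `f`. -/
def weaklyAbove (p : ExtVertex V → ℝ × ℝ) (f : ℝ → ℝ) : Set V :=
  {v | f (p (.vert v)).1 ≤ (p (.vert v)).2}

theorem NoTransitivity.not_adj (hT : NoTransitivity G) {u w v : V}
    (huw : Relation.TransGen G.Adj u w) (hwv : Relation.TransGen G.Adj w v) : ¬ G.Adj u v := by
  obtain ⟨x, hx, hxw⟩ := Relation.TransGen.head'_iff.1 huw
  exact hT u x v hx (hwv.trans_right hxw)

theorem left_of_transGen (hp : IsBounded (extend G) p .zero .infty) {u v : V}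
    (h : Relation.TransGen G.Adj u v) : (p (.vert u)).1 < (p (.vert v)).1 := by
  induction h with
  | single h => exact hp.left_of _ _ (.edge _ _ h)
  | tail _ h ih => exact ih.trans (hp.left_of _ _ (.edge _ _ h))

theorem weaklyBelow_inter_weaklyAbove (p : ExtVertex V → ℝ × ℝ) (f : ℝ → ℝ) :
    weaklyBelow p f ∩ weaklyAbove p f = onCurve p f := by
  ext v
  exact ⟨fun h => le_antisymm h.2 h.1, fun h => ⟨Eq.ge h, Eq.le h⟩⟩

theorem weaklyBelow_union_weaklyAbove (p : ExtVertex V → ℝ × ℝ) (f : ℝ → ℝ) :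
    weaklyBelow p f ∪ weaklyAbove p f = Set.univ := by
  exact Set.eq_univ_of_forall fun v => le_total (p (.vert v)).2 (f (p (.vert v)).1)

theorem edgesIn_inter (G : Digraph V) (W W' : Set V) :
    edgesIn G W ∩ edgesIn G W' = edgesIn G (W ∩ W') := by
  ext q
  exact ⟨fun h => ⟨h.1.1, ⟨h.1.2.1, h.2.2.1⟩, h.1.2.2, h.2.2.2⟩,
    fun h => ⟨⟨h.1, h.2.1.1, h.2.2.1⟩, h.1, h.2.1.2, h.2.2.2⟩⟩

variable [Finite V]

/-- The curve is followed from successor to successor until `infty`; no vertex on it is missed,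
since an edge contains only its extremities. The last clause serves to recognise isolated vertices.
-/
theorem exists_chain_from (hp : IsBounded (extend G) p .zero .infty) {f : ℝ → ℝ}
    (hf : IsCurve (extend G) p (p .zero).1 (p .infty).1 f) (v : V) (hv : v ∈ onCurve p f) :
    ∃ l : List V, List.IsChain G.Adj (v :: l) ∧
      (∀ w, w ∈ v :: l ↔ w ∈ onCurve p f ∧ (p (.vert v)).1 ≤ (p (.vert w)).1) ∧
      (l = [] → ∀ w, ¬ G.Adj v w) := by
  induction v using (wellFounded_right fun v : V => p (.vert v)).induction with
  | _ v ih =>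
  obtain ⟨s, hs, hfs⟩ := hp.exists_succ hf hv (by simp)
  have hbetween : ∀ w ∈ onCurve p f, (p (.vert v)).1 ≤ (p (.vert w)).1 →
      (p (.vert w)).1 ≤ (p s).1 → w = v ∨ .vert w = s := by
    intro w hw h1 h2
    rcases hp.eq_or_eq_of_line hs ⟨h1, h2⟩ (Eq.trans (Eq.symm hw) (hfs _ ⟨h1, h2⟩)) with h | h
    · exact Or.inl (by simpa using h)
    · exact Or.inr h
  have hlt := hp.left_of _ _ hs
  cases hs with
  | edge _ b hvb =>
    have hb : b ∈ onCurve p f := (hfs _ ⟨hlt.le, le_rfl⟩).trans (line_right hlt)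
    obtain ⟨l, hl, hmem, -⟩ := ih b hlt hb
    refine ⟨b :: l, List.isChain_cons_cons.2 ⟨hvb, hl⟩, fun w => ?_, by simp⟩
    rw [List.mem_cons, hmem]
    constructor
    · rintro (rfl | ⟨h1, h2⟩)
      · exact ⟨hv, le_rfl⟩
      · exact ⟨h1, hlt.le.trans h2⟩
    · rintro ⟨h1, h2⟩
      rcases le_total (p (.vert w)).1 (p (.vert b)).1 with h3 | h3
      · rcases hbetween w h1 h2 h3 with h | h
        · exact Or.inl h
        · have hwb : w = b := by simpa using h
          subst hwb
          exact Or.inr ⟨h1, le_rfl⟩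
      · exact Or.inr ⟨h1, h3⟩
  | toInfty _ hmax =>
    refine ⟨[], List.isChain_singleton _, fun w => ?_, fun _ => hmax⟩
    rw [List.mem_singleton]
    constructor
    · rintro rfl
      exact ⟨hv, le_rfl⟩
    · rintro ⟨h1, h2⟩
      exact (hbetween w h1 h2 (hp.le_right _)).resolve_right (by simp)

/-- The vertices of `G` on a curve form a chain, which has an edge unless it consists of an isolated
vertex. -/
theorem exists_chain (hp : IsBounded (extend G) p .zero .infty) {f : ℝ → ℝ}
    (hf : IsCurve (extend G) p (p .zero).1 (p .infty).1 f) :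
    ∃ (a : V) (l : List V), List.IsChain G.Adj (a :: l) ∧ {v | v ∈ a :: l} = onCurve p f ∧
      (l = [] → ∀ w, ¬ G.Adj a w ∧ ¬ G.Adj w a) := by
  obtain ⟨s, hs, hfs⟩ := hp.exists_succ hf (hp.curve_left hf) (by simp)
  have hlt := hp.left_of _ _ hs
  have hs' := hs
  cases hs with
  | fromZero a hmin =>
    have ha : a ∈ onCurve p f := (hfs _ ⟨hlt.le, le_rfl⟩).trans (line_right hlt)
    obtain ⟨l, hl, hmem, hmax⟩ := exists_chain_from hp hf a ha
    refine ⟨a, l, hl, ?_, fun h w => ⟨hmax h w, hmin w⟩⟩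
    ext w
    refine (hmem w).trans ⟨And.left, fun hw => ⟨hw, ?_⟩⟩
    by_contra hwa
    have hI : (p (.vert w)).1 ∈ Set.Icc (p .zero).1 (p (.vert a)).1 :=
      ⟨hp.le_left _, (not_le.1 hwa).le⟩
    rcases hp.eq_or_eq_of_line hs' hI (Eq.trans (Eq.symm hw) (hfs _ hI)) with h | h
    · simp at h
    · exact hwa (h ▸ le_rfl)

theorem ncard_edgesIn_onCurve (hG : NoCircuit G) (hT : NoTransitivity G)
    (hp : IsBounded (extend G) p .zero .infty) {f : ℝ → ℝ}
    (hf : IsCurve (extend G) p (p .zero).1 (p .infty).1 f) :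
    (edgesIn G (onCurve p f)).ncard + 1 = (onCurve p f).ncard := by
  obtain ⟨a, l, hl, hmem, -⟩ := exists_chain hp hf
  rw [← hmem]
  exact ncard_edgesIn_chain hG hT hl

theorem transGen_or_of_onCurve (hp : IsBounded (extend G) p .zero .infty) {f : ℝ → ℝ}
    (hf : IsCurve (extend G) p (p .zero).1 (p .infty).1 f) {u v : V} (hu : u ∈ onCurve p f)
    (hv : v ∈ onCurve p f) :
    u = v ∨ Relation.TransGen G.Adj u v ∨ Relation.TransGen G.Adj v u := by
  obtain ⟨a, l, hl, hmem, -⟩ := exists_chain hp hf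
  rw [← hmem] at hu hv
  have h2 : List.IsChain (Relation.TransGen G.Adj) (a :: l) := hl.imp fun _ _ h => .single h
  have h3 : (a :: l).Pairwise fun x y => x = y ∨ Relation.TransGen G.Adj x y ∨
      Relation.TransGen G.Adj y x :=
    (List.isChain_iff_pairwise.1 h2).imp fun h => Or.inr (Or.inl h)
  have : Std.Symm fun x y => x = y ∨ Relation.TransGen G.Adj x y ∨ Relation.TransGen G.Adj y x :=
    ⟨fun x y h => h.imp Eq.symm Or.symm⟩
  exact List.Pairwise.forall_of_forall (R := fun x y => x = y ∨ Relation.TransGen G.Adj x y ∨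
    Relation.TransGen G.Adj y x) (fun _ _ => Or.inl rfl) h3 hu hv

/-- Vertices on a curve are comparable, so of two different origins the earlier one would have a
transitive edge to `v`. Hence edges starting on a curve are determined by their ends. -/
theorem NoTransitivity.eq_of_adj_onCurve (hT : NoTransitivity G)
    (hp : IsBounded (extend G) p .zero .infty) {f : ℝ → ℝ}
    (hf : IsCurve (extend G) p (p .zero).1 (p .infty).1 f) {u u' v : V} (hu : u ∈ onCurve p f)
    (hu' : u' ∈ onCurve p f) (h : G.Adj u v) (h' : G.Adj u' v) : u = u' := by
  rcases transGen_or_of_onCurve hp hf hu hu' with heq | hlt | hlt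
  · exact heq
  · exact absurd h (hT.not_adj hlt (.single h'))
  · exact absurd h' (hT.not_adj hlt (.single h))

theorem adj_mem_weaklyBelow_or (hp : IsBounded (extend G) p .zero .infty) {f : ℝ → ℝ}
    (hf : IsCurve (extend G) p (p .zero).1 (p .infty).1 f) {u v : V} (h : G.Adj u v) :
    (u ∈ weaklyBelow p f ∧ v ∈ weaklyBelow p f) ∨ (u ∈ weaklyAbove p f ∧ v ∈ weaklyAbove p f) := by
  have he : (extend G).Adj (.vert u) (.vert v) := .edge u v h
  have hlt := hp.left_of _ _ he
  rcases hp.le_or_ge hf he with h | h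
  · have h1 := h _ ⟨le_rfl, hlt.le⟩
    have h2 := h _ ⟨hlt.le, le_rfl⟩
    rw [line_left] at h1
    rw [line_right hlt] at h2
    exact Or.inl ⟨h1, h2⟩
  · have h1 := h _ ⟨le_rfl, hlt.le⟩
    have h2 := h _ ⟨hlt.le, le_rfl⟩
    rw [line_left] at h1
    rw [line_right hlt] at h2
    exact Or.inr ⟨h1, h2⟩

theorem edgesIn_weaklyBelow_union (hp : IsBounded (extend G) p .zero .infty) {f : ℝ → ℝ}
    (hf : IsCurve (extend G) p (p .zero).1 (p .infty).1 f) :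
    edgesIn G (weaklyBelow p f) ∪ edgesIn G (weaklyAbove p f) = {q | G.Adj q.1 q.2} := by
  ext q
  constructor
  · rintro (h | h) <;> exact h.1
  · intro h
    rcases adj_mem_weaklyBelow_or hp hf h with h' | h'
    · exact Or.inl ⟨h, h'⟩
    · exact Or.inr ⟨h, h'⟩

/-- If no curve lies properly between `c` and `c'`, then the vertices of `G` on `c` and on `c'`
differ on one interval only. -/
theorem agree_left_or_right (hp : IsBounded (extend G) p .zero .infty) {c c' : ℝ → ℝ}
    (hc : IsCurve (extend G) p (p .zero).1 (p .infty).1 c)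
    (hc' : IsCurve (extend G) p (p .zero).1 (p .infty).1 c')
    (hle : ∀ x ∈ Set.Icc (p .zero).1 (p .infty).1, c x ≤ c' x)
    (hcov : ∀ g, IsCurve (extend G) p (p .zero).1 (p .infty).1 g →
      (∀ x ∈ Set.Icc (p .zero).1 (p .infty).1, c x ≤ g x) →
      (∀ x ∈ Set.Icc (p .zero).1 (p .infty).1, g x ≤ c' x) →
      (∀ x ∈ Set.Icc (p .zero).1 (p .infty).1, g x ≤ c x) ∨
      ∀ x ∈ Set.Icc (p .zero).1 (p .infty).1, c' x ≤ g x)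
    {s : V} (hs : s ∈ onCurve p c) (hs' : s ∈ onCurve p c') :
    (∀ w ∈ onCurve p c', (p (.vert w)).1 ≤ (p (.vert s)).1 → w ∈ weaklyBelow p c) ∨
      ∀ w ∈ onCurve p c', (p (.vert s)).1 ≤ (p (.vert w)).1 → w ∈ weaklyBelow p c := by
  have hsI := hp.mem_Icc (.vert s)
  have hss : c (p (.vert s)).1 = c' (p (.vert s)).1 := Eq.trans hs (Eq.symm hs')
  -- The curve that switches from `c` to `c'` at `s` lies between them, so it coincides with one of
  -- the two.
  have hg := (hc.mono le_rfl hsI.2).glue (hc'.mono hsI.1 le_rfl) hss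
  rcases hcov _ hg (fun x hx => by split_ifs <;> simp [hle x hx])
    (fun x hx => by split_ifs <;> simp [hle x hx]) with h | h
  · right
    intro w hw hsw
    have h1 := h _ (hp.mem_Icc (.vert w))
    rcases hsw.eq_or_lt with heq | hlt
    · have h2 : c (p (.vert w)).1 = c' (p (.vert w)).1 := by rw [← heq, hss]
      exact (Eq.ge hw).trans h2.ge
    · simp only [not_le.2 hlt, if_false] at h1
      exact (Eq.ge hw).trans h1
  · left
    intro w hw hsw
    have h1 := h _ (hp.mem_Icc (.vert w))
    simp only [hsw, if_true] at h1
    exact (Eq.ge hw).trans h1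

/-- If no curve lies properly between `c` and `c'`, then the edges of `G` between them are on
`c'`. -/
theorem mem_onCurve_of_mem_edgesIn_sdiff (hp : IsBounded (extend G) p .zero .infty) {c c' : ℝ → ℝ}
    (hc : IsCurve (extend G) p (p .zero).1 (p .infty).1 c)
    (hc' : IsCurve (extend G) p (p .zero).1 (p .infty).1 c')
    (hle : ∀ x ∈ Set.Icc (p .zero).1 (p .infty).1, c x ≤ c' x)
    (hcov : ∀ g, IsCurve (extend G) p (p .zero).1 (p .infty).1 g →
      (∀ x ∈ Set.Icc (p .zero).1 (p .infty).1, c x ≤ g x) →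
      (∀ x ∈ Set.Icc (p .zero).1 (p .infty).1, g x ≤ c' x) →
      (∀ x ∈ Set.Icc (p .zero).1 (p .infty).1, g x ≤ c x) ∨
      ∀ x ∈ Set.Icc (p .zero).1 (p .infty).1, c' x ≤ g x)
    {u v : V} (hadj : G.Adj u v) (hu : u ∈ weaklyBelow p c') (hv : v ∈ weaklyBelow p c')
    (hn : ¬ (u ∈ weaklyBelow p c ∧ v ∈ weaklyBelow p c)) :
    u ∈ onCurve p c' ∧ v ∈ onCurve p c' := by
  have he : (extend G).Adj (.vert u) (.vert v) := .edge u v hadj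
  have hlt := hp.left_of _ _ he
  have huI : (p (.vert u)).1 ∈ Set.Icc (p (.vert u)).1 (p (.vert v)).1 := ⟨le_rfl, hlt.le⟩
  have hvI : (p (.vert v)).1 ∈ Set.Icc (p (.vert u)).1 (p (.vert v)).1 := ⟨hlt.le, le_rfl⟩
  have hlu := line_left p (.vert u) (.vert v)
  have hlv := line_right hlt
  suffices h : c' (p (.vert u)).1 ≤ (p (.vert u)).2 ∧ c' (p (.vert v)).1 ≤ (p (.vert v)).2 from
    ⟨le_antisymm h.1 hu, le_antisymm h.2 hv⟩
  rcases hp.le_or_ge hc' he with h' | h'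
  swap
  · exact ⟨(h' _ huI).trans hlu.le, (h' _ hvI).trans hlv.le⟩
  rcases hp.le_or_ge hc he with h | h
  · exact absurd ⟨hlu.ge.trans (h _ huI), hlv.ge.trans (h _ hvI)⟩ hn
  obtain ⟨d, hd, hdl⟩ := hp.exists_curve_edge he
  have hgl : ∀ x ∈ Set.Icc (p (.vert u)).1 (p (.vert v)).1,
      min (c' x) (max (c x) (d x)) = line p (.vert u) (.vert v) x := by
    intro x hx
    rw [hdl x hx, max_eq_right (h x hx), min_eq_right (h' x hx)]
  -- A curve `d` through the edge, clipped between `c` and `c'`, still contains the edge and must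
  -- equal `c` or `c'`.
  rcases hcov _ (hc'.min (hc.max hd)) (fun x hx => le_min (hle x hx) (le_max_left _ _))
    (fun x _ => min_le_left _ _) with hg | hg
  · refine absurd ⟨?_, ?_⟩ hn
    · exact (hlu.symm.trans (hgl _ huI).symm).le.trans (hg _ (hp.mem_Icc _))
    · exact (hlv.symm.trans (hgl _ hvI).symm).le.trans (hg _ (hp.mem_Icc _))
  · exact ⟨(hg _ (hp.mem_Icc _)).trans ((hgl _ huI).trans hlu).le,
      (hg _ (hp.mem_Icc _)).trans ((hgl _ hvI).trans hlv).le⟩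

/-- If no curve lies properly between `c` and `c'`, then at most one independent cycle lies between
them. -/
theorem ncard_edgesIn_le_of_covering (hT : NoTransitivity G)
    (hp : IsBounded (extend G) p .zero .infty) {c c' : ℝ → ℝ}
    (hc : IsCurve (extend G) p (p .zero).1 (p .infty).1 c)
    (hc' : IsCurve (extend G) p (p .zero).1 (p .infty).1 c')
    (hle : ∀ x ∈ Set.Icc (p .zero).1 (p .infty).1, c x ≤ c' x)
    (hcov : ∀ g, IsCurve (extend G) p (p .zero).1 (p .infty).1 g →
      (∀ x ∈ Set.Icc (p .zero).1 (p .infty).1, c x ≤ g x) →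
      (∀ x ∈ Set.Icc (p .zero).1 (p .infty).1, g x ≤ c' x) →
      (∀ x ∈ Set.Icc (p .zero).1 (p .infty).1, g x ≤ c x) ∨
      ∀ x ∈ Set.Icc (p .zero).1 (p .infty).1, c' x ≤ g x) :
    (edgesIn G (weaklyBelow p c')).ncard + (weaklyBelow p c).ncard ≤
      (edgesIn G (weaklyBelow p c)).ncard + (weaklyBelow p c').ncard + 1 := by
  have hW : weaklyBelow p c ⊆ weaklyBelow p c' := fun v hv =>
    le_trans hv (hle _ (hp.mem_Icc (.vert v)))
  have hV := Set.ncard_sdiff_add_ncard_of_subset hW (Set.toFinite _)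
  have hE := Set.ncard_sdiff_add_ncard_of_subset (edgesIn_mono G hW) (Set.toFinite _)
  set N := edgesIn G (weaklyBelow p c') \ edgesIn G (weaklyBelow p c) with hN
  have hon : ∀ q ∈ N, q.1 ∈ onCurve p c' ∧ q.2 ∈ onCurve p c' := fun q hq =>
    mem_onCurve_of_mem_edgesIn_sdiff hp hc hc' hle hcov hq.1.1 hq.1.2.1 hq.1.2.2
      fun h => hq.2 ⟨hq.1.1, h⟩
  have hsplit : N ⊆ {q ∈ N | q.2 ∉ weaklyBelow p c} ∪ {q ∈ N | q.2 ∈ weaklyBelow p c} := by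
    intro q hq
    by_cases h : q.2 ∈ weaklyBelow p c
    · exact Or.inr ⟨hq, h⟩
    · exact Or.inl ⟨hq, h⟩
  -- New edges whose end is a new vertex are counted by their ends.
  have h1 : {q ∈ N | q.2 ∉ weaklyBelow p c}.ncard ≤
      (weaklyBelow p c' \ weaklyBelow p c).ncard := by
    refine Set.ncard_le_ncard_of_injOn Prod.snd (fun q hq => ⟨hq.1.1.2.2, hq.2⟩) ?_
      (Set.toFinite _)
    rintro ⟨u, v⟩ hq ⟨u', v'⟩ hq' heq
    change v = v' at heq
    subst heq
    exact Prod.ext (hT.eq_of_adj_onCurve hp hc' (hon _ hq.1).1 (hon _ hq'.1).1 hq.1.1.1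
      hq'.1.1.1) rfl
  -- A new edge with an old end closes the gap between `c` and `c'`. If `v` came before `v'`, the
  -- curves would agree on one side of `v`, and the edge on that side would not be new. So there is
  -- at most one such edge, the +1 of the bound.
  have hnot : ∀ q ∈ N, ∀ q' ∈ N, q.2 ∈ weaklyBelow p c → q'.2 ∈ weaklyBelow p c →
      ¬ Relation.TransGen G.Adj q.2 q'.2 := by
    rintro ⟨u, v⟩ hq ⟨u', v'⟩ hq' hv hv' hvv'
    have hvc : v ∈ onCurve p c :=
      le_antisymm ((hle _ (hp.mem_Icc _)).trans (Eq.le (hon _ hq).2)) hv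
    rcases agree_left_or_right hp hc hc' hle hcov hvc (hon _ hq).2 with h | h
    · have hu := h u (hon _ hq).1 (left_of_transGen hp (.single hq.1.1)).le
      exact hq.2 ⟨hq.1.1, hu, hv⟩
    · refine hq'.2 ⟨hq'.1.1, h u' (hon _ hq').1 ?_, hv'⟩
      rcases transGen_or_of_onCurve hp hc' (hon _ hq).2 (hon _ hq').1 with heq | hlt | hlt
      · exact (congrArg (fun w => (p (.vert w)).1) heq).le
      · exact (left_of_transGen hp hlt).le
      · exact absurd hq'.1.1 (hT.not_adj hlt hvv')
  have h2 : {q ∈ N | q.2 ∈ weaklyBelow p c}.ncard ≤ 1 := by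
    rw [Set.ncard_le_one (Set.toFinite _)]
    rintro ⟨u, v⟩ hq ⟨u', v'⟩ hq'
    have heq : v = v' := by
      rcases transGen_or_of_onCurve hp hc' (hon _ hq.1).2 (hon _ hq'.1).2 with heq | hlt | hlt
      · exact heq
      · exact absurd hlt (hnot _ hq.1 _ hq'.1 hq.2 hq'.2)
      · exact absurd hlt (hnot _ hq'.1 _ hq.1 hq'.2 hq.2)
    subst heq
    exact Prod.ext (hT.eq_of_adj_onCurve hp hc' (hon _ hq.1).1 (hon _ hq'.1).1 hq.1.1.1
      hq'.1.1.1) rfl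
  have h3 := (Set.ncard_le_ncard hsplit (Set.toFinite _)).trans (Set.ncard_union_le _ _)
  omega

/-- If `G` has at least as many edges as vertices, some curve has as many edges as vertices
weakly below it. -/
theorem exists_curve_ncard_eq (hG : NoCircuit G) (hT : NoTransitivity G)
    (hp : IsBounded (extend G) p .zero .infty)
    (hcard : Nat.card V ≤ {q : V × V | G.Adj q.1 q.2}.ncard) :
    ∃ f, IsCurve (extend G) p (p .zero).1 (p .infty).1 f ∧
      (edgesIn G (weaklyBelow p f)).ncard = (weaklyBelow p f).ncard := by
  obtain ⟨b, hb, hlow⟩ := hp.exists_lowest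
  obtain ⟨h, hh, hhigh⟩ := hp.exists_highest
  have hbW : weaklyBelow p b = onCurve p b := by
    ext v
    refine ⟨fun hv => le_antisymm ?_ hv, fun hv => Eq.ge hv⟩
    obtain ⟨g, hg, hgv⟩ := hp.exists_curve_vertex (.vert v)
    exact (hlow g hg _ (hp.mem_Icc _)).trans hgv.le
  have hbd : (edgesIn G (weaklyBelow p b)).ncard < (weaklyBelow p b).ncard := by
    rw [hbW]
    have := ncard_edgesIn_onCurve hG hT hp hb
    omega
  have hhW : weaklyBelow p h = Set.univ := by
    ext v
    refine ⟨fun _ => trivial, fun _ => ?_⟩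
    obtain ⟨g, hg, hgv⟩ := hp.exists_curve_vertex (.vert v)
    exact hgv.ge.trans (hhigh g hg _ (hp.mem_Icc _))
  have hhd : (weaklyBelow p h).ncard ≤ (edgesIn G (weaklyBelow p h)).ncard := by
    rw [hhW, Set.ncard_univ]
    have : edgesIn G Set.univ = {q : V × V | G.Adj q.1 q.2} := by
      ext q
      simp [edgesIn]
    rwa [this]
  -- `c'` is minimal of excess at least 0, and `c` is maximal of negative excess under `c'`. A curve
  -- between them equals `c` or `c'` according to the sign of its excess, so the excess at `c'` is
  -- at most -1 + 1.
  obtain ⟨c', ⟨hc', hc'd⟩, hmin⟩ := (measure fun f => (below (extend G) p f).ncard).wf.has_min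
    {f | IsCurve (extend G) p (p .zero).1 (p .infty).1 f ∧
      (weaklyBelow p f).ncard ≤ (edgesIn G (weaklyBelow p f)).ncard} ⟨h, hh, hhd⟩
  obtain ⟨c, ⟨hc, hle, hcd⟩, hmax⟩ := exists_max_of_le
    (s := {f | IsCurve (extend G) p (p .zero).1 (p .infty).1 f ∧
      (∀ x ∈ Set.Icc (p .zero).1 (p .infty).1, f x ≤ c' x) ∧
      (edgesIn G (weaklyBelow p f)).ncard < (weaklyBelow p f).ncard}) ⟨b, hb, hlow c' hc', hbd⟩
    (fun f => (below (extend G) p f).ncard) _ (fun f => Set.ncard_le_card _)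
  refine ⟨c', hc', le_antisymm ?_ hc'd⟩
  have := ncard_edgesIn_le_of_covering hT hp hc hc' hle fun g hg hcg hgc' => by
    rcases lt_or_ge (edgesIn G (weaklyBelow p g)).ncard (weaklyBelow p g).ncard with hgd | hgd
    · exact Or.inl (hp.le_of_ncard_le hg hcg (hmax g ⟨hg, hgc', hgd⟩))
    · exact Or.inr (hp.le_of_ncard_le hc' hgc' (not_lt.1 (hmin g ⟨hg, hgd⟩)))
  omega

end Extend

/-! ### The separating chain. -/

/-- Some chain has two regions with a cycle. -/
theorem exists_isChain_two_regions {V : Type u} [Finite V] (G : Digraph V)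
    (hconn : G.toSimpleGraphInclusive.Connected) (hcirc : NoCircuit G) (htrans : NoTransitivity G)
    (hplanar : IsStronglyPlanar G) (hcycles : 1 < numCycles G) :
    ∃ c : List V, IsChain G c ∧ ∃ A B : Component G c, A ≠ B ∧
      1 ≤ numCycles (region G c A) ∧ 1 ≤ numCycles (region G c B) := by
  have : Nonempty V := hconn.nonempty
  have hcard := card_lt_ncard_edgeSet_of_one_lt_encard_cycles hconn hcycles
  rw [hcirc.ncard_edgeSet] at hcard
  obtain ⟨p, hemb⟩ := hplanar
  have hp := isBounded_extend hemb
  obtain ⟨f, hf, hfd⟩ := exists_curve_ncard_eq hcirc htrans hp hcard.le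
  obtain ⟨a, l, hl, hmem, hiso⟩ := exists_chain hp hf
  -- Otherwise `a` is isolated, and by connectedness it is the only vertex, although `G` has edges.
  have hl0 : l ≠ [] := by
    intro h0
    obtain ⟨⟨x, y⟩, hxy⟩ : {q : V × V | G.Adj q.1 q.2}.Nonempty :=
      Set.nonempty_of_ncard_ne_zero (by omega)
    have hall : ∀ w, w = a := by
      intro w
      obtain ⟨P⟩ := hconn.preconnected a w
      cases P with
      | nil => rfl
      | cons h _ =>
        rcases h.2 with h | h
        · exact absurd h (hiso h0 _).1
        · exact absurd h (hiso h0 _).2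
    exact hcirc.ne hxy ((hall x).trans (hall y).symm)
  have hC := ncard_edgesIn_onCurve hcirc htrans hp hf
  have hV := Set.ncard_union_add_ncard_inter (weaklyBelow p f) (weaklyAbove p f)
    (Set.toFinite _) (Set.toFinite _)
  have hE := Set.ncard_union_add_ncard_inter (edgesIn G (weaklyBelow p f))
    (edgesIn G (weaklyAbove p f)) (Set.toFinite _) (Set.toFinite _)
  rw [weaklyBelow_union_weaklyAbove, weaklyBelow_inter_weaklyAbove, Set.ncard_univ] at hV
  rw [edgesIn_inter, weaklyBelow_inter_weaklyAbove, edgesIn_weaklyBelow_union hp hf] at hE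
  have hmem' : ∀ v, v ∈ a :: l ↔ v ∈ weaklyBelow p f ∧ v ∈ weaklyAbove p f := fun v => by
    rw [← Set.mem_inter_iff, weaklyBelow_inter_weaklyAbove, ← hmem]
    rfl
  have hor : ∀ u v, G.Adj u v → _ := fun u v h => adj_mem_weaklyBelow_or hp hf h
  have hcov : ∀ v, v ∈ weaklyBelow p f ∨ v ∈ weaklyAbove p f := fun v =>
    le_total (p (.vert v)).2 (f (p (.vert v)).1)
  rw [← hmem] at hC
  obtain ⟨A, hAW, hA⟩ := exists_component_one_le_numCycles hcirc (c := a :: l)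
    (W := weaklyBelow p f) hC (fun v hv => ((hmem' v).1 hv).1)
    (fun u v huv hu hv => by
      rw [hmem'] at hu hv
      have := hor u v huv
      tauto) hfd.ge
  -- The strict inequality `hcard` is needed here: its surplus of one edge pays for the excess -1 of
  -- the chain, counted on both sides.
  obtain ⟨B, hBW, hB⟩ := exists_component_one_le_numCycles hcirc (c := a :: l)
    (W := weaklyAbove p f) hC (fun v hv => ((hmem' v).1 hv).2)
    (fun u v huv hu hv => by
      rw [hmem'] at hu hv
      have := hor u v huv
      tauto) (by rw [hmem] at hC; omega)
  refine ⟨a :: l, ⟨hl, hcirc.nodup hl, ?_⟩, A, B, ?_, hA, hB⟩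
  · have := List.length_pos_iff.2 hl0
    simp only [List.length_cons]
    omega
  · rintro rfl
    obtain ⟨x, hx⟩ := A.nonempty_supp
    exact x.2 ((hmem' x).2 ⟨hAW ⟨x, hx, rfl⟩, hBW ⟨x, hx, rfl⟩⟩)

end StronglyPlanar

theorem mainTheorem9 {V : Type*} [Finite V] (G : Digraph V)
    (hconn : G.toSimpleGraphInclusive.Connected)
    (hcirc : StronglyPlanar.NoCircuit G)
    (htrans : StronglyPlanar.NoTransitivity G)
    (hplanar : StronglyPlanar.IsStronglyPlanar G)
    (hcycles : 1 < StronglyPlanar.numCycles G) :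
    ∃ c : List V, StronglyPlanar.IsChain G c ∧
      ∃ A B : StronglyPlanar.Component G c, A ≠ B ∧
        1 ≤ StronglyPlanar.numCycles (StronglyPlanar.region G c A) ∧
        1 ≤ StronglyPlanar.numCycles (StronglyPlanar.region G c B) :=
  StronglyPlanar.exists_isChain_two_regions G hconn hcirc htrans hplanar hcycles
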